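/- Let $m,\delta\ge 0$ be integers. For a locally Noetherian scheme $T$, a \emph{family of subalgebras of $\mathbb{Z}^m$ of corank $\delta$ on $T$} is a quasi-coherent sheaf of $\mathcal{O}_T$-subalgebras $\mathcal{B}\subseteq \mathcal{O}_T^m=\mathbb{Z}^m\otimes\mathcal{O}_T$ such that the $\mathcal{O}_T$-module $\mathcal{O}_T^m/\mathcal{B}$ is locally free of rank $\delta$. Families pull back along morphisms of schemes, and $T\mapsto\{\text{families of subalgebras of }\mathbb{Z}^m\text{ of corank }\delta\text{ on }T\}$ is a contravariant functor $F^\delta_{\mathbb{Z}^m}$ from locally Noetherian schemes to sets. The functor $F^\delta_{\mathbb{Z}^m}$ is representable by a locally Noetherian scheme. For any representing scheme $\mathrm{Ter}^\delta_{\mathbb{Z}^m}$ (the \emph{territory}), there is an isomorphism \[ \mathrm{Ter}^\delta_{\mathbb{Z}^m}\;\cong\;\bigsqcup_{\mathcal{P}}\operatorname{Spec}\mathbb{Z}, \] where the disjoint union is over the partitions $\mathcal{P}$ of $\{1,\dots,m\}$ such that $\sum_{P\in\mathcal{P}}(|P|-1)=\delta$. Under this isomorphism, for every locally Noetherian scheme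 $S$ and every such $\mathcal{P}$, the unique $S$-point of the copy of $\operatorname{Spec}\mathbb{Z}$ indexed by $\mathcal{P}$ corresponds to the family of subalgebras \[ \{(a_k)_{k=1}^m\in\mathcal{O}_S^m \mid a_i=a_j \text{ whenever } i,j\in P \text{ for some } P\in\mathcal{P}\}. \] -/

import Mathlib

open CategoryTheory CategoryTheory.Limits AlgebraicGeometry Opposite

universe u

namespace Territory

/-- Restriction of sections of the structure sheaf. -/
def res {T : Scheme.{u}} {U V : T.Opens} (h : V ≤ U) : Γ(T, U) →+* Γ(T, V) :=
  (T.presheaf.map (homOfLE h).op).hom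

/-- Restriction of sections of the sheaf of algebras `𝒪_T ^ m`, coordinate by coordinate. -/
def resVec (m : ℕ) {T : Scheme.{u}} {U V : T.Opens} (h : V ≤ U) :
    (Fin m → Γ(T, U)) →+* (Fin m → Γ(T, V)) :=
  (res h).compLeft (Fin m)

/-- For `g : T ⟶ T'`, the pullback of a section of `𝒪_{T'} ^ m` over `U` to a section of `𝒪_T ^ m`
over an open `W` that maps into `U`. -/
def pullVec (m : ℕ) {T T' : Scheme.{u}} (g : T ⟶ T') {U : T'.Opens} {W : T.Opens}
    (h : W ≤ g ⁻¹ᵁ U) : (Fin m → Γ(T', U)) →+* (Fin m → Γ(T, W)) :=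
  (g.appLE U W h).hom.compLeft (Fin m)

/-- A subsheaf of `𝒪_T`-subalgebras of `𝒪_T ^ m = ℤ ^ m ⊗ 𝒪_T`. -/
@[ext]
structure SubalgebraSheaf (m : ℕ) (T : Scheme.{u}) where
  sections (U : T.Opens) : Subalgebra Γ(T, U) (Fin m → Γ(T, U))
  restrict_mem {U V : T.Opens} (h : V ≤ U) {s : Fin m → Γ(T, U)} :
    s ∈ sections U → resVec m h s ∈ sections V
  mem_of_local {U : T.Opens} {s : Fin m → Γ(T, U)} :
    (∀ x ∈ U, ∃ (V : T.Opens) (h : V ≤ U), x ∈ V ∧ resVec m h s ∈ sections V) → s ∈ sections U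

namespace SubalgebraSheaf

variable {m : ℕ} {T T' T'' : Scheme.{u}}

/-- Quasi-coherence: for `U` affine and `f ∈ Γ(T, U)`, the map from the localization
`ℬ(U)_f` to `ℬ(D(f))` is bijective. Injectivity is automatic for a subsheaf of `𝒪_T ^ m`; the
condition below is surjectivity. -/
def IsQuasicoherent (B : SubalgebraSheaf m T) : Prop :=
  ∀ (U : T.Opens), IsAffineOpen U → ∀ (f : Γ(T, U)),
    ∀ s ∈ B.sections (T.basicOpen f), ∃ n : ℕ, ∃ t ∈ B.sections U,
      resVec m (T.basicOpen_le f) t = res (T.basicOpen_le f) f ^ n • s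

/-- The quotient `𝒪_T ^ m / ℬ` is locally free of rank `δ` (for quasi-coherent `ℬ`, where the
restriction of the quotient sheaf to an affine open `U` is the sheaf associated with the
`Γ(T, U)`-module `Γ(T, U) ^ m / ℬ(U)`). -/
def QuotientLocallyFree (B : SubalgebraSheaf m T) (δ : ℕ) : Prop :=
  ∀ x : T, ∃ U : T.Opens, IsAffineOpen U ∧ x ∈ U ∧
    Nonempty (((Fin m → Γ(T, U)) ⧸ Subalgebra.toSubmodule (B.sections U)) ≃ₗ[Γ(T, U)]
      (Fin δ → Γ(T, U)))

/-! ### Elementary facts on restriction -/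

lemma res_apply {U V : T.Opens} (h : V ≤ U) (a : Γ(T, U)) :
    res h a = T.presheaf.map (homOfLE h).op a := rfl

lemma resVec_apply {U V : T.Opens} (h : V ≤ U) (s : Fin m → Γ(T, U)) (i : Fin m) :
    resVec m h s i = res h (s i) := rfl

lemma res_res {U V W : T.Opens} (h : V ≤ U) (h' : W ≤ V) (a : Γ(T, U)) :
    res h' (res h a) = res (h'.trans h) a := by
  simp only [res, ← CommRingCat.comp_apply, ← Functor.map_comp]
  rfl

lemma res_self {U : T.Opens} (h : U ≤ U) (a : Γ(T, U)) : res h a = a := by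
  simp [res]

lemma resVec_resVec {U V W : T.Opens} (h : V ≤ U) (h' : W ≤ V) (s : Fin m → Γ(T, U)) :
    resVec m h' (resVec m h s) = resVec m (h'.trans h) s :=
  funext fun i => res_res h h' (s i)

lemma resVec_self {U : T.Opens} (h : U ≤ U) (s : Fin m → Γ(T, U)) : resVec m h s = s :=
  funext fun i => res_self h (s i)

lemma resVec_smul {U V : T.Opens} (h : V ≤ U) (a : Γ(T, U)) (s : Fin m → Γ(T, U)) :
    resVec m h (a • s) = res h a • resVec m h s :=
  funext fun i => (res h).map_mul a (s i)

lemma resVec_pullVec (g : T ⟶ T') {U : T'.Opens} {W V : T.Opens} (h : W ≤ g ⁻¹ᵁ U) (h' : V ≤ W)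
    (t : Fin m → Γ(T', U)) :
    resVec m h' (pullVec m g h t) = pullVec m g (h'.trans h) t := by
  funext i
  change (g.appLE U W h ≫ T.presheaf.map (homOfLE h').op) (t i) = _
  rw [Scheme.Hom.appLE_map]
  rfl

lemma pullVec_resVec (g : T ⟶ T') {U U' : T'.Opens} {W : T.Opens} (h : U' ≤ U)
    (h' : W ≤ g ⁻¹ᵁ U') (h'' : W ≤ g ⁻¹ᵁ U) (t : Fin m → Γ(T', U)) :
    pullVec m g h' (resVec m h t) = pullVec m g h'' t := by
  funext i
  change (T'.presheaf.map (homOfLE h).op ≫ g.appLE U' W h') (t i) = _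
  rw [Scheme.Hom.map_appLE]
  rfl

lemma pullVec_id {U W : T.Opens} (h : W ≤ (𝟙 T) ⁻¹ᵁ U) (h' : W ≤ U) (t : Fin m → Γ(T, U)) :
    pullVec m (𝟙 T) h t = resVec m h' t := by
  funext i
  change ((𝟙 T : T ⟶ T).appLE U W h) (t i) = _
  simp [Scheme.Hom.appLE]
  rfl

lemma pullVec_pullVec (f : T ⟶ T') (g : T' ⟶ T'') {U : T''.Opens} {V : T'.Opens} {W : T.Opens}
    (h : V ≤ g ⁻¹ᵁ U) (h' : W ≤ f ⁻¹ᵁ V) (h'' : W ≤ (f ≫ g) ⁻¹ᵁ U) (t : Fin m → Γ(T'', U)) :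
    pullVec m f h' (pullVec m g h t) = pullVec m (f ≫ g) h'' t := by
  funext i
  change (g.appLE U V h ≫ f.appLE V W h') (t i) = _
  rw [Scheme.Hom.appLE_comp_appLE]
  rfl

/-! ### Pullback -/

/-- The sections over `W` of the presheaf pullback of `ℬ` along `g : T ⟶ T'`: pullbacks to `W` of
sections of `ℬ` over opens of `T'` whose preimage contains `W`. -/
def pulledBack (g : T ⟶ T') (B : SubalgebraSheaf m T') (W : T.Opens) :
    Submonoid (Fin m → Γ(T, W)) where
  carrier := {s | ∃ (U : T'.Opens) (h : W ≤ g ⁻¹ᵁ U), ∃ t ∈ B.sections U, pullVec m g h t = s}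
  one_mem' := ⟨⊤, le_top, 1, one_mem _, map_one _⟩
  mul_mem' := by
    rintro _ _ ⟨U, h, t, ht, rfl⟩ ⟨U', h', t', ht', rfl⟩
    have h₀ : W ≤ g ⁻¹ᵁ (U ⊓ U') := le_inf h h'
    refine ⟨U ⊓ U', h₀, resVec m inf_le_left t * resVec m inf_le_right t',
      mul_mem (B.restrict_mem _ ht) (B.restrict_mem _ ht'), ?_⟩
    rw [map_mul, pullVec_resVec g _ h₀ h, pullVec_resVec g _ h₀ h']

lemma span_pulledBack (g : T ⟶ T') (B : SubalgebraSheaf m T') (W : T.Opens)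
    (s : Fin m → Γ(T, W)) :
    s ∈ Submodule.span Γ(T, W) (pulledBack g B W : Set (Fin m → Γ(T, W))) ↔
      s ∈ Algebra.adjoin Γ(T, W) (pulledBack g B W : Set (Fin m → Γ(T, W))) := by
  rw [← Subalgebra.mem_toSubmodule, Algebra.adjoin_eq_span, Submonoid.closure_eq]

lemma resVec_span (g : T ⟶ T') (B : SubalgebraSheaf m T') {W V : T.Opens} (h : V ≤ W)
    (s : Fin m → Γ(T, W))
    (hs : s ∈ Submodule.span Γ(T, W) (pulledBack g B W : Set (Fin m → Γ(T, W)))) :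
    resVec m h s ∈ Submodule.span Γ(T, V) (pulledBack g B V : Set (Fin m → Γ(T, V))) := by
  induction hs using Submodule.span_induction with
  | mem x hx =>
    obtain ⟨U, h', t, ht, rfl⟩ := hx
    exact Submodule.subset_span ⟨U, h.trans h', t, ht, (resVec_pullVec g h' h t).symm⟩
  | zero => rw [map_zero]; exact zero_mem _
  | add x y _ _ hx hy => rw [map_add]; exact add_mem hx hy
  | smul a x _ hx => rw [resVec_smul]; exact Submodule.smul_mem _ _ hx

lemma local_two (g : T ⟶ T') (B : SubalgebraSheaf m T') {V : T.Opens}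
    {s t : Fin m → Γ(T, V)}
    (hs : ∀ x ∈ V, ∃ (W : T.Opens) (h : W ≤ V), x ∈ W ∧ resVec m h s ∈
      Submodule.span Γ(T, W) (pulledBack g B W : Set (Fin m → Γ(T, W))))
    (ht : ∀ x ∈ V, ∃ (W : T.Opens) (h : W ≤ V), x ∈ W ∧ resVec m h t ∈
      Submodule.span Γ(T, W) (pulledBack g B W : Set (Fin m → Γ(T, W)))) :
    ∀ x ∈ V, ∃ (W : T.Opens) (h : W ≤ V), x ∈ W ∧
      resVec m h s ∈ Algebra.adjoin Γ(T, W) (pulledBack g B W : Set (Fin m → Γ(T, W))) ∧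
      resVec m h t ∈ Algebra.adjoin Γ(T, W) (pulledBack g B W : Set (Fin m → Γ(T, W))) := by
  intro x hx
  obtain ⟨W, h, hxW, hW⟩ := hs x hx
  obtain ⟨W', h', hxW', hW'⟩ := ht x hx
  refine ⟨W ⊓ W', inf_le_left.trans h, ⟨hxW, hxW'⟩, ?_, ?_⟩
  · rw [← span_pulledBack, ← resVec_resVec h inf_le_left]
    exact resVec_span g B _ _ hW
  · rw [← span_pulledBack, ← resVec_resVec h' inf_le_right]
    exact resVec_span g B _ _ hW'

/-- The pullback `g^* ℬ` of a sheaf of subalgebras `ℬ ⊆ 𝒪_{T'} ^ m` as a sheaf of subalgebras of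
`g^* 𝒪_{T'} ^ m = 𝒪_T ^ m`, i.e. the image of `g^* ℬ → 𝒪_T ^ m`: its sections are the sections of
`𝒪_T ^ m` that are locally `𝒪_T`-linear combinations of pullbacks of sections of `ℬ`. (The map
`g^* ℬ → 𝒪_T ^ m` is injective when the quotient `𝒪_{T'} ^ m / ℬ` is locally free.) -/
def pullback (g : T ⟶ T') (B : SubalgebraSheaf m T') : SubalgebraSheaf m T where
  sections V :=
    { carrier := {s | ∀ x ∈ V, ∃ (W : T.Opens) (h : W ≤ V), x ∈ W ∧ resVec m h s ∈
        Submodule.span Γ(T, W) (pulledBack g B W : Set (Fin m → Γ(T, W)))}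
      mul_mem' := by
        intro s t hs ht x hx
        obtain ⟨W, h, hxW, h₁, h₂⟩ := local_two g B hs ht x hx
        refine ⟨W, h, hxW, ?_⟩
        rw [span_pulledBack, map_mul]
        exact mul_mem h₁ h₂
      add_mem' := by
        intro s t hs ht x hx
        obtain ⟨W, h, hxW, h₁, h₂⟩ := local_two g B hs ht x hx
        refine ⟨W, h, hxW, ?_⟩
        rw [span_pulledBack, map_add]
        exact add_mem h₁ h₂
      algebraMap_mem' := by
        intro a x hx
        refine ⟨V, le_rfl, hx, ?_⟩
        rw [resVec_self, span_pulledBack]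
        exact Subalgebra.algebraMap_mem _ a }
  restrict_mem := by
    intro U V h s hs x hx
    obtain ⟨W, hW, hxW, hs'⟩ := hs x (h hx)
    refine ⟨W ⊓ V, inf_le_right, ⟨hxW, hx⟩, ?_⟩
    rw [resVec_resVec, ← resVec_resVec hW inf_le_left]
    exact resVec_span g B _ _ hs'
  mem_of_local := by
    intro U s hs x hx
    obtain ⟨V, h, hxV, hV⟩ := hs x hx
    obtain ⟨W, hW, hxW, hs'⟩ := hV x hxV
    refine ⟨W, hW.trans h, hxW, ?_⟩
    rwa [resVec_resVec] at hs'

lemma mem_pullback {g : T ⟶ T'} {B : SubalgebraSheaf m T'} {V : T.Opens}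
    {s : Fin m → Γ(T, V)} : s ∈ (pullback g B).sections V ↔
      ∀ x ∈ V, ∃ (W : T.Opens) (h : W ≤ V), x ∈ W ∧ resVec m h s ∈
        Submodule.span Γ(T, W) (pulledBack g B W : Set (Fin m → Γ(T, W))) := Iff.rfl

lemma span_pulledBack_le (g : T ⟶ T') (B : SubalgebraSheaf m T') (C : SubalgebraSheaf m T)
    (W : T.Opens)
    (H : ∀ (U : T'.Opens) (h : W ≤ g ⁻¹ᵁ U), ∀ t ∈ B.sections U, pullVec m g h t ∈ C.sections W) :
    Submodule.span Γ(T, W) (pulledBack g B W : Set (Fin m → Γ(T, W))) ≤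
      Subalgebra.toSubmodule (C.sections W) := by
  rw [Submodule.span_le]
  rintro _ ⟨U, h, t, ht, rfl⟩
  exact H U h t ht

lemma pullVec_mem_pullback (g : T ⟶ T') (B : SubalgebraSheaf m T') {U : T'.Opens} {W : T.Opens}
    (h : W ≤ g ⁻¹ᵁ U) {t : Fin m → Γ(T', U)} (ht : t ∈ B.sections U) :
    pullVec m g h t ∈ (pullback g B).sections W := fun x hx =>
  ⟨W, le_rfl, hx, by
    rw [resVec_self]
    exact Submodule.subset_span ⟨U, h, t, ht, rfl⟩⟩

lemma pullback_le (g : T ⟶ T') (B : SubalgebraSheaf m T') (C : SubalgebraSheaf m T)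
    (H : ∀ (W : T.Opens) (U : T'.Opens) (h : W ≤ g ⁻¹ᵁ U), ∀ t ∈ B.sections U,
      pullVec m g h t ∈ C.sections W) (V : T.Opens) :
    (pullback g B).sections V ≤ C.sections V := by
  intro s hs
  refine C.mem_of_local fun x hx => ?_
  obtain ⟨W, h, hxW, hW⟩ := hs x hx
  exact ⟨W, h, hxW, span_pulledBack_le g B C W (H W) hW⟩

lemma pullback_id (B : SubalgebraSheaf m T) : pullback (𝟙 T) B = B := by
  ext1
  funext V
  refine le_antisymm (pullback_le _ _ _ (fun W U h t ht => ?_) V) fun s hs => ?_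
  · rw [pullVec_id h (by simpa using h)]
    exact B.restrict_mem _ ht
  · have := pullVec_mem_pullback (𝟙 T) B (W := V) (U := V) (by simp) hs
    rwa [pullVec_id _ le_rfl, resVec_self] at this

lemma pullback_comp (f : T ⟶ T') (g : T' ⟶ T'') (B : SubalgebraSheaf m T'') :
    pullback (f ≫ g) B = pullback f (pullback g B) := by
  ext1
  funext V
  refine le_antisymm (pullback_le _ _ _ (fun W U h t ht => ?_) V)
    (pullback_le _ _ _ (fun W U h t ht => ?_) V)
  · rw [← pullVec_pullVec f g (V := g ⁻¹ᵁ U) le_rfl (by simpa using h) h]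
    exact pullVec_mem_pullback _ _ _ (pullVec_mem_pullback _ _ _ ht)
  · refine mem_of_local _ fun x hx => ?_
    obtain ⟨V', hV', hxV', ht'⟩ := ht (f x) (h hx)
    refine ⟨W ⊓ f ⁻¹ᵁ V', inf_le_left, ⟨hx, hxV'⟩, ?_⟩
    rw [resVec_pullVec, ← pullVec_resVec f hV' inf_le_right]
    generalize resVec m hV' t = t' at ht'
    induction ht' using Submodule.span_induction with
    | mem y hy =>
      obtain ⟨U', h', r, hr, rfl⟩ := hy
      rw [pullVec_pullVec f g h' inf_le_right
        (fun y hy => h' hy.2)]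
      exact pullVec_mem_pullback _ _ _ hr
    | zero => rw [map_zero]; exact zero_mem _
    | add y z _ _ hy hz => rw [map_add]; exact add_mem hy hz
    | smul a y _ hy =>
      have : ∀ b : Γ(T, W ⊓ f ⁻¹ᵁ V'), b • pullVec m f inf_le_right y ∈
        ((pullback (f ≫ g) B).sections (W ⊓ f ⁻¹ᵁ V')) := fun b => Subalgebra.smul_mem _ hy b
      convert this (f.appLE V' _ inf_le_right a) using 1
      exact funext fun i => map_mul (f.appLE V' _ inf_le_right).hom a (y i)

/-! ### Stability of families under pullback -/

/-- Local presentation of `ℬ` as the kernel of a split surjection of free modules. -/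
def LocPres (B : SubalgebraSheaf m T) (δ : ℕ) : Prop :=
  ∀ x : T, ∃ U : T.Opens, x ∈ U ∧ ∃ (M : Matrix (Fin δ) (Fin m) Γ(T, U))
    (N : Matrix (Fin m) (Fin δ) Γ(T, U)), M * N = 1 ∧
    ∀ (V : T.Opens) (h : V ≤ U) (s : Fin m → Γ(T, V)),
      s ∈ B.sections V ↔ (M.map (res h)).mulVec s = 0

lemma map_mulVec' {R S : Type*} [CommRing R] [CommRing S] (f : R →+* S) {a b : ℕ}
    (M : Matrix (Fin a) (Fin b) R) (v : Fin b → R) :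
    (M.map f).mulVec (f.compLeft _ v) = f.compLeft _ (M.mulVec v) := by
  funext i
  exact (f.map_mulVec M v i).symm

lemma eq_zero_of_local {δ : ℕ} {V : T.Opens} (s : Fin δ → Γ(T, V))
    (H : ∀ x ∈ V, ∃ (W : T.Opens) (h : W ≤ V), x ∈ W ∧ resVec δ h s = 0) : s = 0 := by
  funext i
  choose W hW hx hs using H
  refine T.sheaf.eq_of_locally_eq' (fun x : V => W x.1 x.2) V (fun x => homOfLE (hW x.1 x.2))
    (fun x hxV => ?_) _ _ fun x => ?_
  · simp only [TopologicalSpace.Opens.mem_iSup]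
    exact ⟨⟨x, hxV⟩, hx x hxV⟩
  · exact (congrFun (hs x.1 x.2) i).trans (map_zero (res (hW x.1 x.2))).symm

lemma map_map_res {a b : ℕ} {U V W : T.Opens} (h : V ≤ U) (h' : W ≤ V)
    (M : Matrix (Fin a) (Fin b) Γ(T, U)) :
    (M.map (res h)).map (res h') = M.map (res (h'.trans h)) := by
  ext i j
  exact res_res h h' _

lemma LocPres.pullback {δ : ℕ} (g : T ⟶ T') {B : SubalgebraSheaf m T'} (hB : B.LocPres δ) :
    (pullback g B).LocPres δ := by
  intro x
  obtain ⟨U, hxU, M, N, hMN, hker⟩ := hB (g x)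
  let φ : ∀ {V : T.Opens} (_ : V ≤ g ⁻¹ᵁ U), Γ(T', U) →+* Γ(T, V) :=
    fun h => (g.appLE U _ h).hom
  have hφ : ∀ {V : T.Opens} (h : V ≤ g ⁻¹ᵁ U), (M.map (φ le_rfl)).map (res h) = M.map (φ h) := by
    intro V h
    ext i j
    change (g.appLE U _ le_rfl ≫ T.presheaf.map (homOfLE h).op) (M i j) = _
    rw [Scheme.Hom.appLE_map]
    rfl
  refine ⟨g ⁻¹ᵁ U, hxU, M.map (φ le_rfl), N.map (φ le_rfl), ?_, ?_⟩
  · rw [← Matrix.map_mul, hMN]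
    exact Matrix.map_one _ (map_zero _) (map_one _)
  · intro V h s
    rw [hφ]
    constructor
    · intro hs
      apply eq_zero_of_local
      intro y hy
      obtain ⟨W, hW, hyW, hsW⟩ := hs y hy
      refine ⟨W, hW, hyW, ?_⟩
      have e : resVec δ hW ((M.map (φ h)).mulVec s)
          = (M.map (φ (hW.trans h))).mulVec (resVec m hW s) := by
        rw [resVec, ← map_mulVec', ← hφ h, map_map_res, hφ]
        rfl
      rw [e]
      generalize resVec m hW s = s' at hsW
      induction hsW using Submodule.span_induction with
      | mem z hz =>
        obtain ⟨U', h', t, ht, rfl⟩ := hz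
        have h0 := (hker (U' ⊓ U) inf_le_right _).1 (B.restrict_mem inf_le_left ht)
        have hW' : W ≤ g ⁻¹ᵁ (U' ⊓ U) := le_inf h' (hW.trans h)
        have h1 := congrArg (pullVec δ g hW') h0
        rw [map_zero] at h1
        rw [← h1]
        refine Eq.trans ?_ (map_mulVec' (g.appLE _ W hW').hom _ _)
        congr 1
        · ext i j
          change _ = (T'.presheaf.map (homOfLE _).op ≫ g.appLE _ W _) (M i j)
          rw [Scheme.Hom.map_appLE]
          rfl
        · exact (pullVec_resVec g inf_le_left hW' h' t).symm
      | zero => exact Matrix.mulVec_zero _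
      | add y z _ _ hy hz => rw [Matrix.mulVec_add, hy, hz, add_zero]
      | smul a y _ hy => rw [Matrix.mulVec_smul, hy, smul_zero]
    · intro hs y hy
      refine ⟨V, le_rfl, hy, ?_⟩
      rw [resVec_self]
      let P : Matrix (Fin m) (Fin m) Γ(T', U) := 1 - N * M
      have hP : ∀ i, P.col i ∈ B.sections U := by
        intro i
        rw [hker U le_rfl]
        have : M.map (res (le_refl U)) = M := by ext i j; exact res_self _ _
        rw [this]
        have h0 : M * P = 0 := by
          simp only [P, Matrix.mul_sub, Matrix.mul_one,
            ← Matrix.mul_assoc, hMN, Matrix.one_mul, sub_self]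
        funext j
        exact congrFun (congrFun h0 j) i
      have hsum : s = ∑ i, s i • pullVec m g h (P.col i) := by
        have h1 : (P.map (φ h)).mulVec s = s := by
          have : P.map (φ h) = 1 - N.map (φ h) * M.map (φ h) := by
            rw [← Matrix.map_mul, ← Matrix.map_one (φ h) (map_zero _) (map_one _)]
            exact Matrix.map_sub _ (fun a b => map_sub _ a b) _ _
          rw [this, Matrix.sub_mulVec, Matrix.one_mulVec, ← Matrix.mulVec_mulVec, hs,
            Matrix.mulVec_zero, sub_zero]
        conv_lhs => rw [← h1]
        funext j
        simp only [Matrix.mulVec, dotProduct, Finset.sum_apply, Pi.smul_apply, smul_eq_mul]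
        exact Finset.sum_congr rfl fun i _ => mul_comm _ _
      rw [hsum]
      exact Submodule.sum_mem _ fun i _ => Submodule.smul_mem _ _
        (Submodule.subset_span ⟨U, h, _, hP i, rfl⟩)

lemma LocPres.quotientLocallyFree {δ : ℕ} {B : SubalgebraSheaf m T} (hB : B.LocPres δ) :
    B.QuotientLocallyFree δ := by
  intro x
  obtain ⟨U, hxU, M, N, hMN, hker⟩ := hB x
  obtain ⟨V, hV, hxV, hVU⟩ := exists_isAffineOpen_mem_and_subset hxU
  refine ⟨V, hV, hxV, ?_⟩
  have hVU' : V ≤ U := hVU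
  have hMN' : M.map (res hVU') * N.map (res hVU') = 1 := by
    rw [← Matrix.map_mul, hMN]
    exact Matrix.map_one _ (map_zero _) (map_one _)
  have hk : Subalgebra.toSubmodule (B.sections V) = (M.map (res hVU')).mulVecLin.ker := by
    ext s
    exact hker V hVU' s
  have hsurj : Function.Surjective (M.map (res hVU')).mulVecLin := fun v =>
    ⟨(N.map (res hVU')).mulVec v, by
      rw [Matrix.mulVecLin_apply, Matrix.mulVec_mulVec, hMN', Matrix.one_mulVec]⟩
  rw [hk]
  exact ⟨(M.map (res hVU')).mulVecLin.quotKerEquivOfSurjective hsurj⟩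

lemma LocPres.isQuasicoherent {δ : ℕ} {B : SubalgebraSheaf m T} (hB : B.LocPres δ) :
    B.IsQuasicoherent := by
  intro U hU f s hs
  have hf := T.basicOpen_le f
  choose n t ht using fun i => exists_eq_pow_mul_of_isAffineOpen T U hU f (s i)
  let n₀ := Finset.univ.sup n
  have hn : ∀ i, n i ≤ n₀ := fun i => Finset.le_sup (Finset.mem_univ i)
  let t₀ : Fin m → Γ(T, U) := fun i => f ^ (n₀ - n i) * t i
  have ht₀ : resVec m hf t₀ = res hf f ^ n₀ • s := by
    funext i
    have h1 : res hf (t i) = (res hf f) ^ n i * s i := ht i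
    change res hf (f ^ (n₀ - n i) * t i) = res hf f ^ n₀ * s i
    rw [map_mul, map_pow, h1, ← mul_assoc, ← pow_add, Nat.sub_add_cancel (hn i)]
  have key : ∀ x ∈ U, ∃ (V : T.Opens) (h : V ≤ U) (k : ℕ), x ∈ V ∧
      resVec m h (f ^ k • t₀) ∈ B.sections V := by
    intro x hx
    obtain ⟨U', hxU', M, N, hMN, hker⟩ := hB x
    obtain ⟨V, hV, hxV, hVU⟩ := exists_isAffineOpen_mem_and_subset (U := U ⊓ U') ⟨hx, hxU'⟩
    have h1 : V ≤ U := fun y hy => (hVU hy).1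
    have h2 : V ≤ U' := fun y hy => (hVU hy).2
    let v := (M.map (res h2)).mulVec (resVec m h1 t₀)
    have hbo : T.basicOpen (res h1 f) ≤ T.basicOpen f := by
      rw [res_apply, Scheme.basicOpen_res]
      exact inf_le_right
    have hv : ∀ j, ∃ k : ℕ, (res h1 f) ^ k * v j = 0 := by
      intro j
      apply exists_pow_mul_eq_zero_of_res_basicOpen_eq_zero_of_isAffineOpen T hV
      have hle := T.basicOpen_le (res h1 f)
      have h3 : resVec δ hle v = 0 := by
        rw [resVec, ← map_mulVec', map_map_res]
        have h4 : (res hle).compLeft (Fin m) (resVec m h1 t₀)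
            = resVec m hbo (res hf f ^ n₀ • s) := by
          rw [← ht₀, resVec_resVec]
          exact resVec_resVec h1 hle t₀
        rw [h4, ← hker]
        exact B.restrict_mem _ (Subalgebra.smul_mem _ hs _)
      exact congrFun h3 j
    choose k hk using hv
    let k₀ := Finset.univ.sup k
    have hk₀ : ∀ j, k j ≤ k₀ := fun i => Finset.le_sup (Finset.mem_univ i)
    refine ⟨V, h1, k₀, hxV, ?_⟩
    rw [hker V h2, resVec_smul, Matrix.mulVec_smul]
    funext j
    change res h1 (f ^ k₀) * v j = 0
    rw [map_pow, ← Nat.sub_add_cancel (hk₀ j), pow_add, mul_assoc, hk, mul_zero]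
  choose V hVU k hxV hVB using key
  obtain ⟨F, hF⟩ := hU.isCompact.elim_finite_subcover (fun x : U => (V x.1 x.2 : Set T))
    (fun x => (V x.1 x.2).isOpen) (fun x hx => Set.mem_iUnion.2 ⟨⟨x, hx⟩, hxV x hx⟩)
  let K := F.sup fun x : U => k x.1 x.2
  refine ⟨K + n₀, f ^ K • t₀, B.mem_of_local fun x hx => ?_, ?_⟩
  · obtain ⟨y, hyF, hxy⟩ := Set.mem_iUnion₂.1 (hF hx)
    refine ⟨V y.1 y.2, hVU y.1 y.2, hxy, ?_⟩
    have hle : k y.1 y.2 ≤ K := Finset.le_sup (f := fun x : U => k x.1 x.2) hyF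
    rw [← Nat.sub_add_cancel hle, pow_add, mul_smul, resVec_smul]
    exact Subalgebra.smul_mem _ (hVB y.1 y.2) _
  · rw [resVec_smul, ht₀, map_pow, smul_smul, pow_add]

lemma locPres_of {δ : ℕ} {B : SubalgebraSheaf m T} (hq : B.IsQuasicoherent)
    (hB : B.QuotientLocallyFree δ) : B.LocPres δ := by
  intro x
  obtain ⟨U, hU, hxU, ⟨e⟩⟩ := hB x
  let φ : (Fin m → Γ(T, U)) →ₗ[Γ(T, U)] (Fin δ → Γ(T, U)) :=
    e.toLinearMap ∘ₗ (Subalgebra.toSubmodule (B.sections U)).mkQ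
  have hφ : ∀ s, φ s = 0 ↔ s ∈ B.sections U := by
    intro s
    simp [φ]
  have hsurj : Function.Surjective φ := e.surjective.comp (Submodule.mkQ_surjective _)
  obtain ⟨ψ, hψ⟩ := Module.projective_lifting_property φ LinearMap.id hsurj
  let M := LinearMap.toMatrix' φ
  have hM : ∀ s, M.mulVec s = φ s := fun s => by
    rw [← Matrix.toLin'_apply, Matrix.toLin'_toMatrix']
  refine ⟨U, hxU, M, LinearMap.toMatrix' ψ, ?_, ?_⟩
  · rw [← LinearMap.toMatrix'_comp, hψ, LinearMap.toMatrix'_id]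
  · -- first for basic opens of `U`
    have hbasic : ∀ (f : Γ(T, U)) (s : Fin m → Γ(T, T.basicOpen f)),
        s ∈ B.sections (T.basicOpen f) ↔ (M.map (res (T.basicOpen_le f))).mulVec s = 0 := by
      intro f s
      have hf := T.basicOpen_le f
      have hu : IsUnit (res hf f) := T.toRingedSpace.isUnit_res_basicOpen f
      have hcancel : ∀ (n : ℕ), res hf f ^ n • s ∈ B.sections (T.basicOpen f) →
          s ∈ B.sections (T.basicOpen f) := by
        intro n hn
        obtain ⟨w, hw⟩ := (hu.pow n).exists_left_inv
        have := Subalgebra.smul_mem _ hn w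
        rwa [smul_smul, hw, one_smul] at this
      constructor
      · intro hs
        obtain ⟨n, t, ht, hts⟩ := hq U hU f s hs
        have h1 : (M.map (res hf)).mulVec (res hf f ^ n • s) = 0 := by
          rw [← hts]
          exact (map_mulVec' (res hf) M t).trans (by rw [hM, (hφ t).2 ht, map_zero])
        rw [Matrix.mulVec_smul] at h1
        obtain ⟨w, hw⟩ := (hu.pow n).exists_left_inv
        have := congrArg (w • ·) h1
        simpa only [smul_smul, hw, one_smul, smul_zero] using this
      · intro hs
        choose n t ht using fun i => exists_eq_pow_mul_of_isAffineOpen T U hU f (s i)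
        let n₀ := Finset.univ.sup n
        have hn : ∀ i, n i ≤ n₀ := fun i => Finset.le_sup (Finset.mem_univ i)
        let t₀ : Fin m → Γ(T, U) := fun i => f ^ (n₀ - n i) * t i
        have ht₀ : resVec m hf t₀ = res hf f ^ n₀ • s := by
          funext i
          have h1 : res hf (t i) = (res hf f) ^ n i * s i := ht i
          change res hf (f ^ (n₀ - n i) * t i) = res hf f ^ n₀ * s i
          rw [map_mul, map_pow, h1, ← mul_assoc, ← pow_add, Nat.sub_add_cancel (hn i)]
        have hv : ∀ j, ∃ k : ℕ, f ^ k * (M.mulVec t₀) j = 0 := by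
          intro j
          apply exists_pow_mul_eq_zero_of_res_basicOpen_eq_zero_of_isAffineOpen T hU
          have h3 : resVec δ hf (M.mulVec t₀) = 0 := by
            rw [resVec, ← map_mulVec']
            change (M.map (res hf)).mulVec (resVec m hf t₀) = 0
            rw [ht₀, Matrix.mulVec_smul, hs, smul_zero]
          exact congrFun h3 j
        choose k hk using hv
        let k₀ := Finset.univ.sup k
        have hk₀ : ∀ j, k j ≤ k₀ := fun i => Finset.le_sup (Finset.mem_univ i)
        have hmem : f ^ k₀ • t₀ ∈ B.sections U := by
          rw [← hφ, map_smul, ← hM]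
          funext j
          change f ^ k₀ * (M.mulVec t₀) j = 0
          rw [← Nat.sub_add_cancel (hk₀ j), pow_add, mul_assoc, hk, mul_zero]
        have := B.restrict_mem hf hmem
        rw [resVec_smul, ht₀, map_pow, smul_smul, ← pow_add] at this
        exact hcancel _ this
    intro V h s
    have hloc : ∀ y ∈ V, ∃ f : Γ(T, U), T.basicOpen f ≤ V ∧ y ∈ T.basicOpen f := by
      intro y hy
      obtain ⟨f, hf, hyf⟩ := hU.exists_basicOpen_le ⟨y, hy⟩ (h hy)
      exact ⟨f, hf, hyf⟩
    have hcomp : ∀ (f : Γ(T, U)) (hf : T.basicOpen f ≤ V),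
        resVec δ hf ((M.map (res h)).mulVec s)
          = (M.map (res (T.basicOpen_le f))).mulVec (resVec m hf s) := by
      intro f hf
      rw [resVec, ← map_mulVec', map_map_res]
      rfl
    constructor
    · intro hs
      apply eq_zero_of_local
      intro y hy
      obtain ⟨f, hf, hyf⟩ := hloc y hy
      refine ⟨_, hf, hyf, ?_⟩
      rw [hcomp, ← hbasic]
      exact B.restrict_mem _ hs
    · intro hs
      refine B.mem_of_local fun y hy => ?_
      obtain ⟨f, hf, hyf⟩ := hloc y hy
      refine ⟨_, hf, hyf, ?_⟩
      rw [hbasic, ← hcomp, hs, map_zero]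

end SubalgebraSheaf

/-- A family of subalgebras of `ℤ ^ m` of corank `δ` on a scheme `T`: a quasi-coherent sheaf of
`𝒪_T`-subalgebras `ℬ` of `𝒪_T ^ m` such that `𝒪_T ^ m / ℬ` is locally free of rank `δ`. -/
@[ext]
structure Family (m δ : ℕ) (T : Scheme.{u}) extends SubalgebraSheaf m T where
  isQuasicoherent : toSubalgebraSheaf.IsQuasicoherent
  quotientLocallyFree : toSubalgebraSheaf.QuotientLocallyFree δ

/-- Pullback of families of subalgebras. -/
def Family.pullback {m δ : ℕ} {T T' : Scheme.{u}} (g : T ⟶ T') (B : Family m δ T') :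
    Family m δ T where
  toSubalgebraSheaf := B.toSubalgebraSheaf.pullback g
  isQuasicoherent :=
    ((SubalgebraSheaf.locPres_of B.isQuasicoherent B.quotientLocallyFree).pullback g).isQuasicoherent
  quotientLocallyFree :=
    ((SubalgebraSheaf.locPres_of B.isQuasicoherent
      B.quotientLocallyFree).pullback g).quotientLocallyFree

/-- The category of locally Noetherian schemes (as a full subcategory of schemes). Since `Spec ℤ` is
terminal, this is the category of locally Noetherian schemes over `Spec ℤ`. -/
abbrev LocNoethScheme : Type (u + 1) :=
  ObjectProperty.FullSubcategory (fun T : Scheme.{u} => IsLocallyNoetherian T)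

/-- The functor sending a locally Noetherian scheme `T` to the set of families of subalgebras
of `ℤ ^ m` of corank `δ` on `T`, and a morphism to the pullback of families along it. A scheme
representing it is the territory of `ℤ ^ m` of corank `δ`. -/
def territoryFunctor (m δ : ℕ) : LocNoethScheme.{u}ᵒᵖ ⥤ Type u where
  obj T := Family m δ T.unop.obj
  map g := ↾(fun B => Family.pullback g.unop.hom B)
  map_id T := by
    refine ConcreteCategory.hom_ext _ _ fun B => ?_
    exact Family.ext (congrArg SubalgebraSheaf.sections (SubalgebraSheaf.pullback_id B.toSubalgebraSheaf))
  map_comp f g := by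
    refine ConcreteCategory.hom_ext _ _ fun B => ?_
    exact Family.ext (congrArg SubalgebraSheaf.sections (SubalgebraSheaf.pullback_comp g.unop.hom f.unop.hom
      B.toSubalgebraSheaf))

/-- Partitions `Q` of an `m`-element set with `∑_{P ∈ Q} (|P| - 1) = δ`. (Parts of a
`Finpartition` are nonempty, so the subtraction is not truncated.) -/
abbrev PartitionOfCorank (m δ : ℕ) : Type :=
  {Q : Finpartition (Finset.univ : Finset (Fin m)) // ∑ P ∈ Q.parts, (P.card - 1) = δ}

/-- `Spec ℤ` (in an arbitrary universe). -/
noncomputable abbrev SpecZ : Scheme.{u} := Spec (CommRingCat.of (ULift.{u} ℤ))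

end Territory

/-! The point is a rigidity statement over a local ring `R`: a subalgebra `A` of `R ^ m` that is a
direct summand consists of all tuples constant on the parts of some partition. Call `i` and `j`
equivalent if `a i - a j` lies in the maximal ideal for every `a ∈ A`. The differences `a i - a j`
then form a finitely generated ideal `I` with `I ≤ maximalIdeal R • I`, so `I = 0` by Nakayama
(`eq_of_residueSetoid`). Hence elements of `A` are constant on classes. Inequivalent indices are
separated by elements of `A`, and products of these supply the indicators of the classes, so `A`
contains every such tuple (`exists_partition_of_retraction`).

A family is locally the kernel of a matrix `M` with a right inverse `N`. Comparing two such kernels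
amounts to the vanishing of finitely many matrix entries (`mul_one_sub_eq_zero_iff`), so the
partition found at a stalk is valid on a neighbourhood (`exists_partition_nhds`). A family on `T` is
therefore the same as a decomposition of `T` into disjoint opens indexed by partitions of corank `δ`
(`exists_eq_ofOpens`, `ofOpens_injective`), and this is compatible with pullback
(`pullback_ofOpens`).

Since `Spec ℤ` is terminal, such a decomposition is also the same as a morphism from `T` to a
disjoint union of copies of `Spec ℤ` (`hom_ext_of_preimage_sigmaOpen`, `exists_preimage_sigmaOpen`).
This proves representability; uniqueness of representing objects carries the result to any other
territory. -/

namespace Territory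

/-! ### Tuples constant on the parts of a partition -/

/-- A tuple that is constant on every part of a partition of the index set. -/
def IsConstOn {m : ℕ} {R : Type*} (Q : Finpartition (Finset.univ : Finset (Fin m)))
    (a : Fin m → R) : Prop :=
  ∀ P ∈ Q.parts, ∀ i ∈ P, ∀ j ∈ P, a i = a j

lemma IsConstOn.map {m : ℕ} {R S : Type*} {Q : Finpartition (Finset.univ : Finset (Fin m))}
    {a : Fin m → R} (h : IsConstOn Q a) (f : R → S) : IsConstOn Q (fun i => f (a i)) :=
  fun P hP i hi j hj => congrArg f (h P hP i hi j hj)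

lemma isConstOn_iff_part {m : ℕ} {R : Type*} {Q : Finpartition (Finset.univ : Finset (Fin m))}
    {a : Fin m → R} : IsConstOn Q a ↔ ∀ i, ∀ j ∈ Q.part i, a i = a j := by
  constructor
  · exact fun h i j hj => h _ (Q.part_mem.2 (Finset.mem_univ i)) i
      (Q.mem_part (Finset.mem_univ i)) j hj
  · intro h P hP i hi j hj
    rw [← Q.part_eq_of_mem hP hi] at hj
    exact h i j hj

open scoped Classical in
lemma isConstOn_indicator {m : ℕ} (R : Type*) [Zero R] [One R]
    {Q : Finpartition (Finset.univ : Finset (Fin m))} {P : Finset (Fin m)} (hP : P ∈ Q.parts) :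
    IsConstOn Q (fun i => if i ∈ P then (1 : R) else 0) := by
  intro P' hP' i hi j hj
  have : i ∈ P ↔ j ∈ P := by
    rw [← Q.part_eq_iff_mem hP, ← Q.part_eq_iff_mem hP, Q.part_eq_of_mem hP' hi,
      Q.part_eq_of_mem hP' hj]
  simp only [this]

-- Spanning by indicators is what makes base change work: the entries 0 and 1 are preserved by every
-- ring map.
open scoped Classical in
lemma IsConstOn.eq_sum {m : ℕ} {R : Type*} [CommRing R]
    {Q : Finpartition (Finset.univ : Finset (Fin m))} {a : Fin m → R} (h : IsConstOn Q a) :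
    ∃ c : Finset (Fin m) → R, a = ∑ P ∈ Q.parts, c P • fun i => if i ∈ P then (1 : R) else 0 := by
  refine ⟨fun P => if hP : P.Nonempty then a hP.choose else 0, funext fun i => ?_⟩
  have hi := Q.mem_part (Finset.mem_univ i)
  have hpi := Q.part_mem.2 (Finset.mem_univ i)
  rw [Finset.sum_apply, Finset.sum_eq_single (Q.part i)]
  · have hne : (Q.part i).Nonempty := ⟨i, hi⟩
    simp only [Pi.smul_apply, hi, if_true, smul_eq_mul, mul_one, dif_pos hne]
    exact h _ hpi _ hi _ hne.choose_spec
  · intro P hP hne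
    have : i ∉ P := fun h => hne (Q.part_eq_of_mem hP h).symm
    simp [this]
  · exact fun h => (h hpi).elim

/-- The indicator of the part of `i` detects that part, because `1 ≠ 0` in `R`. -/
lemma eq_of_isConstOn_iff {m : ℕ} {R : Type*} [CommRing R] [Nontrivial R]
    {Q Q' : Finpartition (Finset.univ : Finset (Fin m))}
    (h : ∀ s : Fin m → R, IsConstOn Q s ↔ IsConstOn Q' s) : Q = Q' := by
  classical
  have key : ∀ {Q Q' : Finpartition (Finset.univ : Finset (Fin m))},
      (∀ s : Fin m → R, IsConstOn Q s → IsConstOn Q' s) → ∀ i, Q'.part i ⊆ Q.part i := by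
    intro Q Q' h i j hj
    have h1 := isConstOn_iff_part.1
      (h _ (isConstOn_indicator R (Q.part_mem.2 (Finset.mem_univ i)))) i j hj
    simp only [Q.mem_part (Finset.mem_univ i), if_true] at h1
    by_contra hji
    simp [hji] at h1
  have hpart : ∀ i, Q.part i = Q'.part i := fun i =>
    (key (fun s => (h s).2) i).antisymm (key (fun s => (h s).1) i)
  ext P
  constructor
  · intro hP
    obtain ⟨i, hi⟩ := Q.nonempty_of_mem_parts hP
    rw [← Q.part_eq_of_mem hP hi, hpart]
    exact Q'.part_mem.2 (Finset.mem_univ i)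
  · intro hP
    obtain ⟨i, hi⟩ := Q'.nonempty_of_mem_parts hP
    rw [← Q'.part_eq_of_mem hP hi, ← hpart]
    exact Q.part_mem.2 (Finset.mem_univ i)

/-! ### Direct-summand subalgebras of `R ^ m` over a local ring -/

section LocalAlgebra

variable {R : Type*} [CommRing R] [IsLocalRing R] {m : ℕ}

open IsLocalRing

/-- Two indices are equivalent when the corresponding coordinates of all elements of a subalgebra
agree modulo the maximal ideal. -/
def residueSetoid (A : Subalgebra R (Fin m → R)) : Setoid (Fin m) where
  r i j := ∀ a ∈ A, a i - a j ∈ maximalIdeal R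
  iseqv :=
    { refl := fun i a _ => by simp
      symm := fun h a ha => by simpa using neg_mem (h a ha)
      trans := fun h h' a ha => by simpa using add_mem (h a ha) (h' a ha) }

/-- Some difference `a i - a j` is a unit; subtracting the constant `a j` and rescaling normalises
the two values. -/
lemma exists_separating {A : Subalgebra R (Fin m → R)} {i j : Fin m}
    (h : ¬ (residueSetoid A).r i j) : ∃ a ∈ A, a i = 1 ∧ a j = 0 := by
  change ¬ ∀ a ∈ A, a i - a j ∈ maximalIdeal R at h
  push Not at h
  obtain ⟨a, ha, hu⟩ := h
  rw [mem_maximalIdeal, mem_nonunits_iff, not_not] at hu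
  obtain ⟨w, hw⟩ := hu.exists_left_inv
  refine ⟨w • (a - algebraMap R _ (a j)),
    A.smul_mem (sub_mem ha (A.algebraMap_mem _)) _, ?_, ?_⟩
  · simpa using hw
  · simp

/-- Multiply the separating elements over all `j` inequivalent to `i`. The values at other indices
of the class of `i` are not controlled yet. -/
lemma exists_classFunction (A : Subalgebra R (Fin m → R)) (i : Fin m) :
    ∃ e ∈ A, e i = 1 ∧ ∀ j, ¬ (residueSetoid A).r i j → e j = 0 := by
  classical
  choose! a haA hai haj using fun j => exists_separating (A := A) (i := i) (j := j)
  refine ⟨∏ j ∈ Finset.univ.filter (fun j => ¬ (residueSetoid A).r i j), a j,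
    prod_mem fun j hj => haA j (Finset.mem_filter.1 hj).2, ?_, fun j hj => ?_⟩
  · rw [Finset.prod_apply]
    exact Finset.prod_eq_one fun j hj => hai j (Finset.mem_filter.1 hj).2
  · rw [Finset.prod_apply]
    exact Finset.prod_eq_zero (Finset.mem_filter.2 ⟨Finset.mem_univ _, hj⟩) (haj j hj)

/-- In a subalgebra that is a direct summand, coordinates that agree modulo the maximal ideal
agree. -/
lemma eq_of_residueSetoid {A : Subalgebra R (Fin m → R)} (p : (Fin m → R) →ₗ[R] (Fin m → R))
    (hpA : ∀ s, p s ∈ A) (hp : ∀ s ∈ A, p s = s) {i j : Fin m}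
    (hij : (residueSetoid A).r i j) {a : Fin m → R} (ha : a ∈ A) : a i = a j := by
  classical
  let D : (Fin m → R) →ₗ[R] R := (LinearMap.proj i : (Fin m → R) →ₗ[R] R) - LinearMap.proj j
  have hD : ∀ s, D s = s i - s j := fun s => rfl
  let I : Ideal R := Submodule.map D (Subalgebra.toSubmodule A)
  have hDI : ∀ s ∈ A, D s ∈ I := fun s hs => ⟨s, hs, rfl⟩
  have hrange : Subalgebra.toSubmodule A = LinearMap.range p := by
    ext s
    exact ⟨fun hs => ⟨s, hp s hs⟩, by rintro ⟨t, rfl⟩; exact hpA t⟩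
  -- Nakayama needs finite generation; `A` is finitely generated as the image of the projector `p`.
  have hfg : I.FG := by
    change (Submodule.map D (Subalgebra.toSubmodule A)).FG
    rw [hrange]
    rw [LinearMap.range_eq_map]
    exact (Module.Finite.fg_top.map p).map D
  -- Applying `p` to the expansion of `s` in the standard basis writes `s` as a combination of
  -- elements of `A` with coefficients in the maximal ideal. This is where the direct summand
  -- hypothesis enters.
  have hsmall : ∀ s ∈ A, (∀ l, s l ∈ maximalIdeal R) → D s ∈ maximalIdeal R • I := by
    intro s hs hl
    have h1 : s = ∑ l, s l • p (Pi.single l 1) := by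
      conv_lhs => rw [← hp s hs, pi_eq_sum_univ' s, map_sum]
      simp only [map_smul]
    rw [h1, map_sum]
    refine sum_mem fun l _ => ?_
    rw [map_smul]
    exact Submodule.smul_mem_smul (hl l) (hDI _ (hpA _))
  have hI : I ≤ maximalIdeal R • I := by
    rintro _ ⟨b, hb, rfl⟩
    have hb : b ∈ A := hb
    obtain ⟨e, heA, hei, hej⟩ := exists_classFunction A i
    -- All coordinates of `b * e - b i • e` lie in the maximal ideal: on the class of `i` because
    -- `b` is constant there modulo it, elsewhere because `e` vanishes.
    have h1 : D (b * e - b i • e) ∈ maximalIdeal R • I := by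
      refine hsmall _ (sub_mem (mul_mem hb heA) (A.smul_mem heA _)) fun l => ?_
      by_cases hl : (residueSetoid A).r i l
      · have : (b * e - b i • e) l = - ((b i - b l) * e l) := by
          simp only [Pi.sub_apply, Pi.mul_apply, Pi.smul_apply, smul_eq_mul]; ring
        rw [this]
        exact neg_mem (Ideal.mul_mem_right _ _ (hl b hb))
      · simp [hej l hl]
    have h2 : D e * D b ∈ maximalIdeal R • I := Submodule.smul_mem_smul (hij e heA) (hDI b hb)
    -- As `e i = 1`, the first term is `e j * D b` and the second is `(1 - e j) * D b`.
    have h3 : D b = D (b * e - b i • e) + D e * D b := by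
      simp only [hD, Pi.sub_apply, Pi.mul_apply, Pi.smul_apply, smul_eq_mul, hei]; ring
    rw [h3]
    exact add_mem h1 h2
  have hbot : I = ⊥ :=
    Submodule.eq_bot_of_le_smul_of_le_jacobson_bot _ _ hfg hI (maximalIdeal_le_jacobson _)
  have := hDI a ha
  rw [hbot, Submodule.mem_bot, hD] at this
  exact sub_eq_zero.1 this

/-- By `eq_of_residueSetoid` the class functions take the value 1 on their whole class, so they are
the indicators, and these span the tuples constant on classes. -/
lemma exists_partition_of_retraction {A : Subalgebra R (Fin m → R)}
    (p : (Fin m → R) →ₗ[R] (Fin m → R)) (hpA : ∀ s, p s ∈ A) (hp : ∀ s ∈ A, p s = s) :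
    ∃ Q : Finpartition (Finset.univ : Finset (Fin m)), ∀ s, s ∈ A ↔ IsConstOn Q s := by
  classical
  let r := residueSetoid A
  refine ⟨Finpartition.ofSetoid r, fun s => ?_⟩
  simp only [isConstOn_iff_part, Finpartition.mem_part_ofSetoid_iff_rel]
  refine ⟨fun hs i j hij => eq_of_residueSetoid p hpA hp hij hs, fun hs => ?_⟩
  choose e heA hei hej using exists_classFunction A
  have h1 : s = ∑ q : Quotient r, s q.out • e q.out := by
    funext l
    rw [Finset.sum_apply, Finset.sum_eq_single (Quotient.mk r l)]
    · have hl : r (Quotient.mk r l).out l := Quotient.mk_out l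
      simp [← eq_of_residueSetoid p hpA hp hl (heA _), hei, hs _ _ hl]
    · intro q _ hq
      have : ¬ (residueSetoid A).r q.out l := fun h =>
        hq (by rw [← Quotient.sound (s := r) h, Quotient.out_eq])
      simp [hej _ _ this]
    · simp
  rw [h1]
  exact sum_mem fun q _ => A.smul_mem (heA _) _

end LocalAlgebra

/-! ### Split matrices and their kernels -/

section Matrices

variable {m δ : ℕ}

/-- The tuples that are constant on the parts of a partition are the kernel of a split surjective
integer matrix. -/
lemma exists_matrix_isConstOn (Q : Finpartition (Finset.univ : Finset (Fin m)))
    (hQ : ∑ P ∈ Q.parts, (P.card - 1) = δ) :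
    ∃ (M : Matrix (Fin δ) (Fin m) ℤ) (N : Matrix (Fin m) (Fin δ) ℤ), M * N = 1 ∧
      ∀ (R : Type u) [CommRing R] (s : Fin m → R),
        (M.map (Int.castRingHom R)).mulVec s = 0 ↔ IsConstOn Q s := by
  classical
  have hne : ∀ P ∈ Q.parts, P.Nonempty := fun P hP => Q.nonempty_of_mem_parts hP
  -- The choice of representatives below needs `Fin m` to be nonempty.
  rcases Nat.eq_zero_or_pos m with rfl | hm
  · have h0 : Q.parts = ∅ := Finset.eq_empty_of_forall_notMem fun P hP =>
      (hne P hP).elim fun i _ => i.elim0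
    rw [h0, Finset.sum_empty] at hQ
    subst hQ
    exact ⟨0, 0, Subsingleton.elim _ _, fun R _ s =>
      ⟨fun _ P _ i => i.elim0, fun _ => Subsingleton.elim _ _⟩⟩
  have : Nonempty (Fin m) := ⟨⟨0, hm⟩⟩
  -- `c` picks a representative of each part. The rows of `M` will express `s l = s (r l)` for the
  -- non-representatives `l`, and `N` will be the inclusion of those coordinates.
  choose! c hc using hne
  let r : Fin m → Fin m := fun i => c (Q.part i)
  have hpm : ∀ i, Q.part i ∈ Q.parts := fun i => Q.part_mem.2 (Finset.mem_univ i)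
  have hr : ∀ i, r i ∈ Q.part i := fun i => hc _ (hpm i)
  have hrr : ∀ i j, j ∈ Q.part i → r j = r i := fun i j h => by
    simp only [r, Q.part_eq_of_mem (hpm i) h]
  have hinj : Set.InjOn c Q.parts := by
    intro P hP P' hP' h
    have h1 := hc P hP
    rw [h] at h1
    exact (Q.part_eq_of_mem hP h1).symm.trans (Q.part_eq_of_mem hP' (hc P' hP'))
  have himg : Finset.univ.filter (fun i => r i = i) = Q.parts.image c := by
    ext i
    simp only [Finset.mem_filter, Finset.mem_univ, true_and, Finset.mem_image]
    constructor
    · exact fun h => ⟨_, hpm i, h⟩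
    · rintro ⟨P, hP, rfl⟩
      simp only [r, Q.part_eq_of_mem hP (hc P hP)]
  -- There is one representative per part, so the number of other indices is the sum of all `P.card
  -- - 1`.
  have hcard : Fintype.card {i // r i ≠ i} = δ := by
    have h1 : (Finset.univ.filter (fun i => r i = i)).card = Q.parts.card := by
      rw [himg, Finset.card_image_of_injOn hinj]
    have h2 := Finset.card_filter_add_card_filter_not (s := (Finset.univ : Finset (Fin m)))
      (fun i => r i = i)
    have h3 : ∑ P ∈ Q.parts, P.card = ∑ P ∈ Q.parts, (P.card - 1) + Q.parts.card := by
      rw [Finset.card_eq_sum_ones, ← Finset.sum_add_distrib]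
      exact Finset.sum_congr rfl fun P hP =>
        (Nat.sub_add_cancel (Finset.card_pos.2 (Q.nonempty_of_mem_parts hP))).symm
    rw [Q.sum_card_parts, hQ, ← h2, h1, add_comm, add_left_inj] at h3
    rw [Fintype.card_subtype]
    convert h3
  let ε : Fin δ ≃ {i // r i ≠ i} := (Fintype.equivFinOfCardEq hcard).symm
  refine ⟨Matrix.of fun k l => (if l = (ε k).1 then 1 else 0) - (if l = r (ε k).1 then 1 else 0),
    Matrix.of fun l k => if l = (ε k).1 then 1 else 0, ?_, fun R _ s => ?_⟩
  · ext k k'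
    have h1 : (ε k').1 ≠ r (ε k).1 := fun h => (ε k').2 (by
      rw [h]; exact hrr _ _ (hr _))
    simp only [Matrix.mul_apply, Matrix.of_apply, mul_ite, mul_one, mul_zero, Finset.sum_ite_eq',
      Finset.mem_univ, if_true, Matrix.one_apply, if_neg h1, sub_zero]
    simp only [Subtype.val_inj, ε.injective.eq_iff, eq_comm]
  · have h1 : ∀ k, ((Matrix.of fun k l => (if l = (ε k).1 then (1 : ℤ) else 0) -
        (if l = r (ε k).1 then 1 else 0)).map (Int.castRingHom R)).mulVec s k
        = s (ε k).1 - s (r (ε k).1) := by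
      intro k
      simp [Matrix.mulVec, dotProduct, sub_mul, Finset.sum_sub_distrib]
    have h2 : ∀ i, (∀ k, s (ε k).1 - s (r (ε k).1) = 0) → s i = s (r i) := by
      intro i h
      by_cases hi : r i = i
      · rw [hi]
      · simpa [sub_eq_zero] using h (ε.symm ⟨i, hi⟩)
    rw [funext_iff]
    simp only [h1, Pi.zero_apply]
    constructor
    · intro h P hP i hi j hj
      have hj' : j ∈ Q.part i := by rwa [Q.part_eq_of_mem hP hi]
      rw [h2 i h, h2 j h, hrr i j hj']
    · intro h k
      rw [sub_eq_zero]
      exact h _ (hpm (ε k).1) _ (Q.mem_part (Finset.mem_univ _)) _ (hr _)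

/-- Both numbers are the rank of the quotient of `R ^ m` by the common kernel. -/
lemma rank_eq_of_ker_eq {R : Type*} [CommRing R] [Nontrivial R] {a b : ℕ}
    (M : Matrix (Fin a) (Fin m) R) (N : Matrix (Fin m) (Fin a) R) (hMN : M * N = 1)
    (M' : Matrix (Fin b) (Fin m) R) (N' : Matrix (Fin m) (Fin b) R) (hMN' : M' * N' = 1)
    (h : ∀ s, M.mulVec s = 0 ↔ M'.mulVec s = 0) : a = b := by
  have hs : ∀ {c : ℕ} (M : Matrix (Fin c) (Fin m) R) (N : Matrix (Fin m) (Fin c) R),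
      M * N = 1 → Function.Surjective M.mulVecLin := fun M N hMN v =>
    ⟨N.mulVec v, by rw [Matrix.mulVecLin_apply, Matrix.mulVec_mulVec, hMN, Matrix.one_mulVec]⟩
  have hk : LinearMap.ker M.mulVecLin = LinearMap.ker M'.mulVecLin := by
    ext s
    exact h s
  have e := (M.mulVecLin.quotKerEquivOfSurjective (hs M N hMN)).symm ≪≫ₗ
    Submodule.quotEquivOfEq _ _ hk ≪≫ₗ M'.mulVecLin.quotKerEquivOfSurjective (hs M' N' hMN')
  simpa using e.finrank_eq

/-- `1 - N * M` is a projector onto the kernel of `M`. Inclusion of kernels thus becomes a matrix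
identity, which survives base change and can be spread out from a stalk. -/
lemma mul_one_sub_eq_zero_iff {R : Type*} [CommRing R] {a b : ℕ}
    {M : Matrix (Fin a) (Fin m) R} {N : Matrix (Fin m) (Fin a) R} (hMN : M * N = 1)
    (L : Matrix (Fin b) (Fin m) R) :
    L * (1 - N * M) = 0 ↔ ∀ s, M.mulVec s = 0 → L.mulVec s = 0 := by
  constructor
  · intro h s hs
    have : s = (1 - N * M).mulVec s := by
      rw [Matrix.sub_mulVec, Matrix.one_mulVec, ← Matrix.mulVec_mulVec, hs, Matrix.mulVec_zero,
        sub_zero]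
    rw [this, Matrix.mulVec_mulVec, h, Matrix.zero_mulVec]
  · intro h
    have h0 : M * (1 - N * M) = 0 := by
      rw [Matrix.mul_sub, Matrix.mul_one, ← Matrix.mul_assoc, hMN, Matrix.one_mul, sub_self]
    ext i j
    have h1 : L.mulVec ((1 - N * M).col j) = 0 :=
      h _ (funext fun k => congrFun (congrFun h0 k) j)
    exact congrFun h1 i

/-- If `M` is a split surjective matrix whose kernel becomes closed under multiplication after
base change to a local ring, then the kernel is given by a partition there. -/
lemma exists_partition_of_isLocalRing {S R : Type*} [CommRing S] [CommRing R] [IsLocalRing R]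
    (γ : S →+* R) (M : Matrix (Fin δ) (Fin m) S) (N : Matrix (Fin m) (Fin δ) S) (hMN : M * N = 1)
    (A : Subalgebra S (Fin m → S)) (hA : ∀ s, s ∈ A ↔ M.mulVec s = 0) :
    ∃ Q : Finpartition (Finset.univ : Finset (Fin m)),
      ∀ s, (M.map γ).mulVec s = 0 ↔ IsConstOn Q s := by
  let M' := M.map γ
  let N' := N.map γ
  have hMN' : M' * N' = 1 := by
    rw [← Matrix.map_mul, hMN]
    exact Matrix.map_one _ (map_zero _) (map_one _)
  have hγ : ∀ v : Fin m → S, M.mulVec v = 0 → M'.mulVec (γ ∘ v) = 0 := by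
    intro v hv
    funext i
    rw [← γ.map_mulVec M v i, hv]
    exact map_zero γ
  let P := 1 - N * M
  have hP : ∀ i, P.col i ∈ A := by
    intro i
    rw [hA]
    have h0 : M * P = 0 := (mul_one_sub_eq_zero_iff hMN M).2 fun _ h => h
    exact funext fun j => congrFun (congrFun h0 j) i
  let K : Submodule R (Fin m → R) := LinearMap.ker M'.mulVecLin
  -- The splitting makes the kernel commute with base change: it is spanned by images of columns of
  -- `P`, which lie in `A`. Closure under multiplication then only has to be checked on these.
  have hK : K ≤ Submodule.span R (Set.range fun i => (γ ∘ P.col i : Fin m → R)) := by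
    intro s hs
    have hs : M'.mulVec s = 0 := hs
    have hP' : P.map γ = 1 - N' * M' := by
      rw [← Matrix.map_mul, ← Matrix.map_one γ (map_zero _) (map_one _)]
      exact Matrix.map_sub _ (fun a b => map_sub _ a b) _ _
    have h1 : s = (P.map γ).mulVec s := by
      rw [hP', Matrix.sub_mulVec, Matrix.one_mulVec, ← Matrix.mulVec_mulVec, hs,
        Matrix.mulVec_zero, sub_zero]
    have h2 : s = ∑ i, s i • (γ ∘ P.col i : Fin m → R) := by
      conv_lhs => rw [h1]
      funext j
      simp only [Matrix.mulVec, dotProduct, Finset.sum_apply, Pi.smul_apply, smul_eq_mul]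
      exact Finset.sum_congr rfl fun i _ => mul_comm _ _
    rw [h2]
    exact Submodule.sum_mem _ fun i _ =>
      Submodule.smul_mem _ _ (Submodule.subset_span ⟨i, rfl⟩)
  have hmul : K * K ≤ K := by
    refine (mul_le_mul' hK hK).trans ?_
    rw [Submodule.span_mul_span, Submodule.span_le]
    rintro _ ⟨_, ⟨i, rfl⟩, _, ⟨j, rfl⟩, rfl⟩
    have := hγ _ ((hA _).1 (mul_mem (hP i) (hP j)))
    have h1 : (γ ∘ (P.col i * P.col j) : Fin m → R) = (γ ∘ P.col i) * (γ ∘ P.col j) :=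
      funext fun k => map_mul γ _ _
    rw [h1] at this
    exact this
  have hone : (1 : Fin m → R) ∈ K := by
    have := hγ _ ((hA _).1 (one_mem A))
    have h1 : (γ ∘ (1 : Fin m → S) : Fin m → R) = 1 := funext fun k => map_one γ
    rw [h1] at this
    exact this
  let A' : Subalgebra R (Fin m → R) := K.toSubalgebra hone
    fun x y hx hy => hmul (Submodule.mul_mem_mul hx hy)
  refine exists_partition_of_retraction (A := A') (1 - N' * M').mulVecLin (fun s => ?_)
    fun s hs => ?_
  · change M'.mulVec ((1 - N' * M').mulVec s) = 0
    rw [Matrix.mulVec_mulVec, (mul_one_sub_eq_zero_iff hMN' M').2 fun _ h => h,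
      Matrix.zero_mulVec]
  · have hs : M'.mulVec s = 0 := hs
    rw [Matrix.mulVecLin_apply, Matrix.sub_mulVec, Matrix.one_mulVec, ← Matrix.mulVec_mulVec, hs,
      Matrix.mulVec_zero, sub_zero]

end Matrices

/-! ### From stalks to neighbourhoods -/

variable {m δ : ℕ} {T T' : Scheme.{u}}

/-- Finitely many sections that vanish in the stalk at a point vanish near the point. -/
lemma exists_res_eq_zero {ι : Type*} [Finite ι] {U : T.Opens} {x : T} (hx : x ∈ U)
    (a : ι → Γ(T, U)) (ha : ∀ k, (T.presheaf.germ U x hx).hom (a k) = 0) :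
    ∃ (V : T.Opens) (h : V ≤ U), x ∈ V ∧ ∀ k, res h (a k) = 0 := by
  have H : ∀ k, ∃ (V : T.Opens) (h : V ≤ U), x ∈ V ∧ res h (a k) = 0 := by
    intro k
    obtain ⟨W, hxW, i, j, hij⟩ := T.presheaf.germ_eq x hx hx (a k) 0
      ((ha k).trans (map_zero (T.presheaf.germ U x hx).hom).symm)
    exact ⟨W, i.le, hxW, hij.trans (map_zero (T.presheaf.map j.op).hom)⟩
  choose V hV hxV hk using H
  let W : T.Opens := ⟨(U : Set T) ∩ ⋂ k, (V k : Set T),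
    U.isOpen.inter (isOpen_iInter_of_finite fun k => (V k).isOpen)⟩
  have hW : ∀ k, W ≤ V k := fun k y hy => Set.mem_iInter.1 hy.2 k
  refine ⟨W, fun y hy => hy.1, ⟨hx, Set.mem_iInter.2 hxV⟩, fun k => ?_⟩
  rw [← SubalgebraSheaf.res_res (hV k) (hW k), hk, map_zero]

/-- Locally, a family of subalgebras is given by a partition. -/
lemma exists_partition_nhds {B : SubalgebraSheaf m T} (hB : B.LocPres δ) (x : T) :
    ∃ (Q : PartitionOfCorank m δ) (U : T.Opens), x ∈ U ∧ ∀ V ≤ U, ∀ s : Fin m → Γ(T, V),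
      s ∈ B.sections V ↔ IsConstOn Q.1 s := by
  obtain ⟨U, hxU, M, N, hMN, hker⟩ := hB x
  let γ := (T.presheaf.germ U x hxU).hom
  have hM : ∀ {S : Type u} [CommRing S] (f : Γ(T, U) →+* S), M.map f * N.map f = 1 := by
    intro S _ f
    rw [← Matrix.map_mul, hMN]
    exact Matrix.map_one _ (map_zero _) (map_one _)
  have hres : M.map (res (le_refl U)) = M := by
    ext i j
    exact SubalgebraSheaf.res_self _ _
  obtain ⟨Q, hQ⟩ := exists_partition_of_isLocalRing γ M N hMN (B.sections U) fun s => by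
    rw [hker U le_rfl, hres]
  have hQδ : ∑ P ∈ Q.parts, (P.card - 1) = δ := by
    -- Present `Q` with its own corank first; comparing ranks over the stalk shows that this corank
    -- is `δ`.
    obtain ⟨L, L', hL, hLQ⟩ := exists_matrix_isConstOn.{u} Q rfl
    refine (rank_eq_of_ker_eq _ _ (hM γ) (L.map (Int.castRingHom _))
      (L'.map (Int.castRingHom _)) ?_ fun s => (hQ s).trans (hLQ _ s).symm).symm
    rw [← Matrix.map_mul, hL]
    exact Matrix.map_one _ (map_zero _) (map_one _)
  obtain ⟨L, L', hL, hLQ⟩ := exists_matrix_isConstOn.{u} Q hQδ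
  let l (S : Type u) [CommRing S] := L.map (Int.castRingHom S)
  let l' (S : Type u) [CommRing S] := L'.map (Int.castRingHom S)
  have hl : ∀ (S : Type u) [CommRing S], l S * l' S = 1 := by
    intro S _
    rw [← Matrix.map_mul, hL]
    exact Matrix.map_one _ (map_zero _) (map_one _)
  have hlf : ∀ {S S' : Type u} [CommRing S] [CommRing S'] (f : S →+* S'),
      (l S).map f = l S' ∧ (l' S).map f = l' S' := by
    intro S S' _ _ f
    constructor <;> ext i j <;> simp [l, l']
  have hmap : ∀ {S : Type u} [CommRing S] (f : Γ(T, U) →+* S),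
      (M * (1 - l' Γ(T, U) * l Γ(T, U))).map f = M.map f * (1 - l' S * l S) ∧
      (l Γ(T, U) * (1 - N * M)).map f = l S * (1 - N.map f * M.map f) := by
    intro S _ f
    have h1 : ∀ X : Matrix (Fin m) (Fin m) Γ(T, U), (1 - X).map f = 1 - X.map f := by
      intro X
      rw [← Matrix.map_one f (map_zero _) (map_one _)]
      exact Matrix.map_sub _ (fun a b => map_sub _ a b) _ _
    constructor
    · rw [Matrix.map_mul, h1, Matrix.map_mul, (hlf f).1, (hlf f).2]
    · rw [Matrix.map_mul, h1, Matrix.map_mul, (hlf f).1]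
  -- The entries of the two products express the two inclusions between the kernels. They are
  -- indexed by one finite type so that a single neighbourhood kills all of them.
  have hstalk : ∀ k : (Fin δ × Fin m) ⊕ (Fin δ × Fin m), γ (Sum.elim
      (fun k => (M * (1 - l' Γ(T, U) * l Γ(T, U)) : Matrix _ _ Γ(T, U)) k.1 k.2)
      (fun k => (l Γ(T, U) * (1 - N * M) : Matrix _ _ Γ(T, U)) k.1 k.2) k) = 0 := by
    rintro (⟨i, j⟩ | ⟨i, j⟩)
    · have h1 := (mul_one_sub_eq_zero_iff (hl _) (M.map γ)).2
        fun s hs => (hQ s).2 ((hLQ _ s).1 hs)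
      rw [← (hmap γ).1] at h1
      exact congrFun (congrFun h1 i) j
    · have h1 := (mul_one_sub_eq_zero_iff (hM γ) (l _)).2
        fun s hs => (hLQ _ s).2 ((hQ s).1 hs)
      rw [← (hmap γ).2] at h1
      exact congrFun (congrFun h1 i) j
  obtain ⟨V, hVU, hxV, hV⟩ := exists_res_eq_zero hxU _ hstalk
  refine ⟨⟨Q, hQδ⟩, V, hxV, fun W hW s => ?_⟩
  have hWU := hW.trans hVU
  rw [hker W hWU, ← hLQ]
  have hV' : ∀ k, res hWU _ = 0 := fun k => by
    rw [← SubalgebraSheaf.res_res hVU hW, hV k, map_zero]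
  constructor
  · refine (mul_one_sub_eq_zero_iff (hM _) (l _)).1 ?_ s
    rw [← (hmap (res hWU)).2]
    ext i j
    exact hV' (Sum.inr (i, j))
  · refine (mul_one_sub_eq_zero_iff (hl _) (M.map (res hWU))).1 ?_ s
    rw [← (hmap (res hWU)).1]
    ext i j
    exact hV' (Sum.inl (i, j))

/-! ### Families as decompositions into disjoint opens -/

lemma eq_of_local {V : T.Opens} {a b : Γ(T, V)}
    (H : ∀ x ∈ V, ∃ (W : T.Opens) (h : W ≤ V), x ∈ W ∧ res h a = res h b) : a = b := by
  have := SubalgebraSheaf.eq_zero_of_local (fun _ : Fin 1 => a - b) fun x hx => by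
    obtain ⟨W, h, hxW, e⟩ := H x hx
    exact ⟨W, h, hxW, funext fun _ => (map_sub (res h) a b).trans (sub_eq_zero.2 e)⟩
  exact sub_eq_zero.1 (congrFun this 0)

lemma SubalgebraSheaf.ext_of_local {B C : SubalgebraSheaf m T}
    (H : ∀ x : T, ∃ U : T.Opens, x ∈ U ∧ ∀ V ≤ U, ∀ s : Fin m → Γ(T, V),
      s ∈ B.sections V ↔ s ∈ C.sections V) : B = C := by
  have key : ∀ {B C : SubalgebraSheaf m T}, (∀ x : T, ∃ U : T.Opens, x ∈ U ∧ ∀ V ≤ U,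
      ∀ s : Fin m → Γ(T, V), s ∈ B.sections V ↔ s ∈ C.sections V) →
      ∀ V, B.sections V ≤ C.sections V := by
    intro B C H V s hs
    refine C.mem_of_local fun x hx => ?_
    obtain ⟨U, hxU, hU⟩ := H x
    exact ⟨V ⊓ U, inf_le_left, ⟨hx, hxU⟩, (hU _ inf_le_right _).1 (B.restrict_mem _ hs)⟩
  ext1
  funext V
  refine le_antisymm (key H V) (key (fun x => ?_) V)
  obtain ⟨U, hxU, hU⟩ := H x
  exact ⟨U, hxU, fun V hV s => (hU V hV s).symm⟩

/-- For opens `W Q` indexed by partitions, the subalgebra sheaf of the sections of `𝒪_T ^ m` whose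
restriction to each `W Q` is constant on the parts of `Q`. -/
def ofOpens (W : PartitionOfCorank m δ → T.Opens) : SubalgebraSheaf m T where
  sections U :=
    { carrier := {s | ∀ Q, IsConstOn Q.1 (resVec m (inf_le_left : U ⊓ W Q ≤ U) s)}
      mul_mem' := fun {s t} hs ht Q P hP i hi j hj => by
        rw [map_mul, Pi.mul_apply, Pi.mul_apply, hs Q P hP i hi j hj, ht Q P hP i hi j hj]
      add_mem' := fun {s t} hs ht Q P hP i hi j hj => by
        rw [map_add, Pi.add_apply, Pi.add_apply, hs Q P hP i hi j hj, ht Q P hP i hi j hj]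
      algebraMap_mem' := fun a Q P hP i hi j hj => rfl }
  restrict_mem {U V} h s hs Q := by
    have := (hs Q).map (res (inf_le_inf_right (W Q) h))
    intro P hP i hi j hj
    have h1 := this P hP i hi j hj
    simp only [SubalgebraSheaf.resVec_apply, SubalgebraSheaf.res_res] at h1 ⊢
    exact h1
  mem_of_local {U s} H Q P hP i hi j hj := by
    refine eq_of_local fun x hx => ?_
    obtain ⟨V, hV, hxV, hs⟩ := H x hx.1
    refine ⟨V ⊓ W Q, inf_le_inf_right _ hV, ⟨hxV, hx.2⟩, ?_⟩
    have h1 := hs Q P hP i hi j hj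
    simp only [SubalgebraSheaf.resVec_apply, SubalgebraSheaf.res_res] at h1 ⊢
    exact h1

/-- A decomposition of a scheme into disjoint opens. -/
structure IsDisjointCover {ι : Type*} (W : ι → T.Opens) : Prop where
  exists_mem (x : T) : ∃ i, x ∈ W i
  eq_of_mem {x : T} {i j : ι} : x ∈ W i → x ∈ W j → i = j

lemma IsDisjointCover.preimage {ι : Type*} {W : ι → T'.Opens} (hW : IsDisjointCover W)
    (g : T ⟶ T') : IsDisjointCover (fun i => g ⁻¹ᵁ W i) :=
  ⟨fun x => hW.exists_mem (g x), fun hi hj => hW.eq_of_mem hi hj⟩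

/-- The conditions for partitions other than `Q` live on empty opens, where any two sections agree.
-/
lemma mem_ofOpens_of_le {W : PartitionOfCorank m δ → T.Opens} (hW : IsDisjointCover W)
    {Q : PartitionOfCorank m δ} {V : T.Opens} (hV : V ≤ W Q) {s : Fin m → Γ(T, V)} :
    s ∈ (ofOpens W).sections V ↔ IsConstOn Q.1 s := by
  constructor
  · intro hs P hP i hi j hj
    have h1 := ((hs Q).map (res (le_inf le_rfl hV))) P hP i hi j hj
    simpa only [SubalgebraSheaf.resVec_apply, SubalgebraSheaf.res_res,
      SubalgebraSheaf.res_self] using h1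
  · intro hs Q'
    by_cases h : Q = Q'
    · subst h
      exact hs.map _
    · exact fun P hP i hi j hj => eq_of_local fun x hx =>
        (h (hW.eq_of_mem (hV hx.1) hx.2)).elim

lemma locPres_ofOpens {W : PartitionOfCorank m δ → T.Opens} (hW : IsDisjointCover W) :
    (ofOpens W).LocPres δ := by
  intro x
  obtain ⟨Q, hxQ⟩ := hW.exists_mem x
  obtain ⟨L, L', hL, hLQ⟩ := exists_matrix_isConstOn.{u} Q.1 Q.2
  refine ⟨W Q, hxQ, L.map (Int.castRingHom _), L'.map (Int.castRingHom _), ?_, fun V hV s => ?_⟩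
  · rw [← Matrix.map_mul, hL]
    exact Matrix.map_one _ (map_zero _) (map_one _)
  · have : (L.map (Int.castRingHom Γ(T, W Q))).map (res hV) = L.map (Int.castRingHom Γ(T, V)) := by
      ext i j
      simp
    rw [this, hLQ, mem_ofOpens_of_le hW hV]

/-- Constancy on parts is preserved by pulling back sections. Conversely, on the preimage of `W Q`
the constant tuples are combinations of indicators, each of which is a pullback. -/
lemma pullback_ofOpens {W : PartitionOfCorank m δ → T'.Opens} (hW : IsDisjointCover W)
    (g : T ⟶ T') : (ofOpens W).pullback g = ofOpens fun Q => g ⁻¹ᵁ W Q := by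
  classical
  refine SubalgebraSheaf.ext_of_local fun x => ?_
  obtain ⟨Q, hxQ⟩ := hW.exists_mem (g x)
  refine ⟨g ⁻¹ᵁ W Q, hxQ, fun V hV s => ⟨fun hs => ?_, fun hs => ?_⟩⟩
  · refine SubalgebraSheaf.pullback_le g (ofOpens W) (ofOpens fun Q => g ⁻¹ᵁ W Q)
      (fun V' U h t ht Q' => ?_) V hs
    have h' : V' ⊓ g ⁻¹ᵁ W Q' ≤ g ⁻¹ᵁ (U ⊓ W Q') := inf_le_inf_right _ h
    have h1 := (ht Q').map (g.appLE _ _ h').hom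
    have h2 : resVec m (inf_le_left : V' ⊓ g ⁻¹ᵁ W Q' ≤ V') (pullVec m g h t)
        = pullVec m g h' (resVec m inf_le_left t) := by
      rw [SubalgebraSheaf.resVec_pullVec,
        SubalgebraSheaf.pullVec_resVec g inf_le_left h' (inf_le_left.trans h)]
    rw [h2]
    exact h1
  · rw [mem_ofOpens_of_le (hW.preimage g) hV] at hs
    obtain ⟨c, hc⟩ := hs.eq_sum
    rw [hc]
    refine sum_mem fun P hP => Subalgebra.smul_mem _ ?_ _
    have h1 := SubalgebraSheaf.pullVec_mem_pullback g (ofOpens W) hV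
      ((mem_ofOpens_of_le hW le_rfl).2 (isConstOn_indicator _ hP))
    convert h1 using 1
    funext i
    change _ = (g.appLE _ _ hV).hom (if i ∈ P then 1 else 0)
    split_ifs <;> simp

/-- The overlap is a nonempty open, so its ring of sections is nontrivial and determines the
partition. -/
lemma eq_of_locally_isConstOn {B : SubalgebraSheaf m T} {Q Q' : PartitionOfCorank m δ}
    {U U' : T.Opens}
    (hU : ∀ V ≤ U, ∀ s : Fin m → Γ(T, V), s ∈ B.sections V ↔ IsConstOn Q.1 s)
    (hU' : ∀ V ≤ U', ∀ s : Fin m → Γ(T, V), s ∈ B.sections V ↔ IsConstOn Q'.1 s)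
    {x : T} (hx : x ∈ U) (hx' : x ∈ U') : Q = Q' := by
  have : Nonempty (U ⊓ U' : T.Opens) := ⟨⟨x, hx, hx'⟩⟩
  exact Subtype.ext (eq_of_isConstOn_iff (R := Γ(T, U ⊓ U'))
    fun s => (hU _ inf_le_left s).symm.trans (hU' _ inf_le_right s))

lemma ofOpens_injective {W W' : PartitionOfCorank m δ → T.Opens} (hW : IsDisjointCover W)
    (hW' : IsDisjointCover W') (h : ofOpens W = ofOpens W') : W = W' := by
  have key : ∀ {W W' : PartitionOfCorank m δ → T.Opens}, IsDisjointCover W → IsDisjointCover W' →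
      ofOpens W = ofOpens W' → ∀ Q, W Q ≤ W' Q := by
    intro W W' hW hW' h Q x hx
    obtain ⟨Q', hx'⟩ := hW'.exists_mem x
    have : Q = Q' := eq_of_locally_isConstOn (B := ofOpens W)
      (fun V hV s => mem_ofOpens_of_le hW hV)
      (fun V hV s => by rw [h]; exact mem_ofOpens_of_le hW' hV) hx hx'
    rwa [this]
  exact funext fun Q => (key hW hW' h Q).antisymm (key hW' hW h.symm Q)

/-- Take for `W Q` the union of all opens on which `B` is given by `Q`. These cover by
`exists_partition_nhds` and are disjoint by `eq_of_locally_isConstOn`. -/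
lemma exists_eq_ofOpens {B : SubalgebraSheaf m T} (hB : B.LocPres δ) :
    ∃ W : PartitionOfCorank m δ → T.Opens, IsDisjointCover W ∧ B = ofOpens W := by
  let p : PartitionOfCorank m δ → T.Opens → Prop := fun Q U =>
    ∀ V ≤ U, ∀ s : Fin m → Γ(T, V), s ∈ B.sections V ↔ IsConstOn Q.1 s
  have hW : IsDisjointCover fun Q => sSup {U | p Q U} := by
    constructor
    · intro x
      obtain ⟨Q, U, hxU, hU⟩ := exists_partition_nhds hB x
      exact ⟨Q, TopologicalSpace.Opens.mem_sSup.2 ⟨U, hU, hxU⟩⟩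
    · intro x Q Q' hx hx'
      obtain ⟨U, hU, hxU⟩ := TopologicalSpace.Opens.mem_sSup.1 hx
      obtain ⟨U', hU', hxU'⟩ := TopologicalSpace.Opens.mem_sSup.1 hx'
      exact eq_of_locally_isConstOn hU hU' hxU hxU'
  refine ⟨_, hW, SubalgebraSheaf.ext_of_local fun x => ?_⟩
  obtain ⟨Q, U, hxU, hU⟩ := exists_partition_nhds hB x
  exact ⟨U, hxU, fun V hV s => (hU V hV s).trans
    (mem_ofOpens_of_le hW (hV.trans (le_sSup (a := U) hU))).symm⟩

/-- The family of subalgebras given by a decomposition into disjoint opens indexed by partitions. -/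
def Family.ofOpens (W : PartitionOfCorank m δ → T.Opens) (hW : IsDisjointCover W) :
    Family m δ T where
  toSubalgebraSheaf := Territory.ofOpens W
  isQuasicoherent := (locPres_ofOpens hW).isQuasicoherent
  quotientLocallyFree := (locPres_ofOpens hW).quotientLocallyFree

lemma Family.toSubalgebraSheaf_injective :
    Function.Injective (Family.toSubalgebraSheaf (m := m) (δ := δ) (T := T)) :=
  fun _ _ h => Family.ext (congrArg SubalgebraSheaf.sections h)

instance isLocallyNoetherian_SpecZ : IsLocallyNoetherian SpecZ.{u} := by
  have : IsNoetherianRing (ULift.{u} ℤ) := isNoetherianRing_of_ringEquiv ℤ ULift.ringEquiv.symm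
  have : IsNoetherianRing (CommRingCat.of (ULift.{u} ℤ)) := this
  infer_instance

/-! ### Morphisms to a disjoint union of copies of `Spec ℤ` -/

section SigmaSpecZ

variable (ι : Type)

/-- A disjoint union of copies of `Spec ℤ`. -/
noncomputable abbrev SigmaSpecZ : Scheme.{u} := ∐ fun _ : ι => SpecZ.{u}

instance isLocallyNoetherian_sigmaSpecZ : IsLocallyNoetherian (SigmaSpecZ.{u} ι) :=
  (isLocallyNoetherian_iff_openCover (sigmaOpenCover _)).mpr
    fun _ => inferInstanceAs (IsLocallyNoetherian SpecZ)

variable {ι}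

/-- The open copy of `Spec ℤ` with a given index. -/
noncomputable def sigmaOpen (i : ι) : (SigmaSpecZ.{u} ι).Opens :=
  (Sigma.ι (fun _ : ι => SpecZ.{u}) i).opensRange

lemma isDisjointCover_sigmaOpen : IsDisjointCover (sigmaOpen.{u} (ι := ι)) where
  exists_mem x := by
    let 𝒰 := sigmaOpenCover fun _ : ι => SpecZ.{u}
    exact ⟨𝒰.idx x, 𝒰.covers x⟩
  eq_of_mem {x i j} hi hj := by
    by_contra h
    exact (disjoint_opensRange_sigmaι (fun _ : ι => SpecZ.{u}) i j h).le_bot ⟨hi, hj⟩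

lemma IsDisjointCover.isOpenCover {W : ι → T.Opens} (hW : IsDisjointCover W) :
    TopologicalSpace.IsOpenCover W :=
  TopologicalSpace.IsOpenCover.mk <| eq_top_iff.2 fun x _ =>
    TopologicalSpace.Opens.mem_iSup.2 (hW.exists_mem x)

/-- On the preimage of the copy with index `i`, a morphism factors through that copy, and
terminality leaves no choice. -/
lemma hom_ext_of_preimage_sigmaOpen {g g' : T ⟶ SigmaSpecZ.{u} ι}
    (h : ∀ i, g ⁻¹ᵁ sigmaOpen i = g' ⁻¹ᵁ sigmaOpen i) : g = g' := by
  have hW := isDisjointCover_sigmaOpen.{u}.preimage (ι := ι) g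
  refine Scheme.Cover.hom_ext (T.openCoverOfIsOpenCover _ hW.isOpenCover) _ _ fun i => ?_
  change (g ⁻¹ᵁ sigmaOpen i).ι ≫ g = (g ⁻¹ᵁ sigmaOpen i).ι ≫ g'
  have key : ∀ k : T ⟶ SigmaSpecZ.{u} ι, g ⁻¹ᵁ sigmaOpen i ≤ k ⁻¹ᵁ sigmaOpen i →
      (g ⁻¹ᵁ sigmaOpen i).ι ≫ k = specULiftZIsTerminal.from _ ≫ Sigma.ι (fun _ => SpecZ.{u}) i := by
    intro k hk
    have hr : Set.range ((g ⁻¹ᵁ sigmaOpen i).ι ≫ k)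
        ⊆ Set.range (Sigma.ι (fun _ : ι => SpecZ.{u}) i) := by
      rintro _ ⟨y, rfl⟩
      exact hk y.2
    rw [← IsOpenImmersion.lift_fac _ _ hr]
    congr 1
    exact specULiftZIsTerminal.hom_ext _ _
  rw [key g le_rfl, key g' (h i).le]

lemma exists_preimage_sigmaOpen {W : ι → T.Opens} (hW : IsDisjointCover W) :
    ∃ g : T ⟶ SigmaSpecZ.{u} ι, ∀ i, g ⁻¹ᵁ sigmaOpen i = W i := by
  let 𝒰 := T.openCoverOfIsOpenCover W hW.isOpenCover
  let f : ∀ i, 𝒰.X i ⟶ SigmaSpecZ.{u} ι := fun i =>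
    specULiftZIsTerminal.from _ ≫ Sigma.ι (fun _ : ι => SpecZ.{u}) i
  have hf : ∀ i j, pullback.fst (𝒰.f i) (𝒰.f j) ≫ f i = pullback.snd _ _ ≫ f j := by
    intro i j
    by_cases hij : i = j
    · subst hij
      simp only [f, ← Category.assoc]
      congr 1
      exact specULiftZIsTerminal.hom_ext _ _
    -- For distinct indices the overlap is empty, so the gluing condition is an equality of maps out
    -- of an initial object.
    · have : IsEmpty ↑(pullback (𝒰.f i) (𝒰.f j)) := by
        refine ⟨fun z => hij ?_⟩
        let y : W i := pullback.fst (𝒰.f i) (𝒰.f j) z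
        let y' : W j := pullback.snd (𝒰.f i) (𝒰.f j) z
        have hy : y.1 = y'.1 := by
          change (pullback.fst (𝒰.f i) (𝒰.f j) ≫ 𝒰.f i) z
            = (pullback.snd (𝒰.f i) (𝒰.f j) ≫ 𝒰.f j) z
          rw [pullback.condition]
        exact hW.eq_of_mem y.2 (hy ▸ y'.2)
      exact isInitialOfIsEmpty.hom_ext _ _
  let g := Scheme.Cover.glueMorphisms 𝒰 f hf
  have hle : ∀ i, W i ≤ g ⁻¹ᵁ sigmaOpen i := by
    intro i x hx
    have h1 : (W i).ι ≫ g = f i := Scheme.Cover.ι_glueMorphisms 𝒰 f hf i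
    change g x ∈ sigmaOpen i
    have h2 : g x = f i ⟨x, hx⟩ := by rw [← h1]; rfl
    rw [h2]
    exact ⟨specULiftZIsTerminal.from (𝒰.X i) ⟨x, hx⟩, rfl⟩
  -- The reverse inclusion follows from disjointness of the copies, since the `W j` already cover
  -- `T`.
  refine ⟨g, fun i => le_antisymm (fun x hx => ?_) (hle i)⟩
  obtain ⟨j, hj⟩ := hW.exists_mem x
  rwa [isDisjointCover_sigmaOpen.eq_of_mem hx (hle j hj)]

end SigmaSpecZ

/-! ### Representability -/

/-- The disjoint union of copies of `Spec ℤ` indexed by the partitions of corank `δ`, as a locally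
Noetherian scheme. -/
noncomputable abbrev territory (m δ : ℕ) : LocNoethScheme.{u} :=
  ⟨SigmaSpecZ.{u} (PartitionOfCorank m δ), isLocallyNoetherian_sigmaSpecZ _⟩

/-- The universal family on the territory. -/
noncomputable def universalFamily (m δ : ℕ) :
    Family.{u} m δ (SigmaSpecZ.{u} (PartitionOfCorank m δ)) :=
  Family.ofOpens sigmaOpen isDisjointCover_sigmaOpen

lemma pullback_universalFamily (g : T ⟶ SigmaSpecZ.{u} (PartitionOfCorank m δ)) :
    Family.pullback g (universalFamily m δ) = Family.ofOpens (fun Q => g ⁻¹ᵁ sigmaOpen Q)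
      (isDisjointCover_sigmaOpen.preimage g) :=
  Family.toSubalgebraSheaf_injective (pullback_ofOpens isDisjointCover_sigmaOpen g)

/-- Morphisms and families are both classified by decompositions into disjoint opens indexed by
partitions, and pulling back the universal family matches the two. -/
lemma bijective_pullback_universalFamily : Function.Bijective
    fun g : T ⟶ SigmaSpecZ.{u} (PartitionOfCorank m δ) =>
      Family.pullback g (universalFamily m δ) := by
  constructor
  · intro g g' h
    simp only [pullback_universalFamily] at h
    have h1 := ofOpens_injective (isDisjointCover_sigmaOpen.preimage g)
      (isDisjointCover_sigmaOpen.preimage g') (congrArg Family.toSubalgebraSheaf h)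
    exact hom_ext_of_preimage_sigmaOpen (congrFun h1)
  · intro B
    obtain ⟨W, hW, hB⟩ := exists_eq_ofOpens
      (SubalgebraSheaf.locPres_of B.isQuasicoherent B.quotientLocallyFree)
    obtain ⟨g, hg⟩ := exists_preimage_sigmaOpen hW
    refine ⟨g, ?_⟩
    simp only [pullback_universalFamily]
    apply Family.toSubalgebraSheaf_injective
    rw [hB, ← funext hg]
    rfl

/-- The territory represents the functor of families of subalgebras. -/
noncomputable def territoryRepresentableBy (m δ : ℕ) :
    (territoryFunctor.{u} m δ).RepresentableBy (territory m δ) where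
  homEquiv {T} := (InducedCategory.homEquiv).trans
    (Equiv.ofBijective _ (bijective_pullback_universalFamily (T := T.obj) (m := m) (δ := δ)))
  homEquiv_comp f g :=
    Family.ext (congrArg SubalgebraSheaf.sections (SubalgebraSheaf.pullback_comp f.hom g.hom _))

/-- The morphism lands in the copy indexed by `Q`, so every open of `T` lies in the preimage of that
copy. -/
lemma mem_pullback_sigma (Q : PartitionOfCorank m δ) (p : T ⟶ SpecZ.{u}) (U : T.Opens)
    (a : Fin m → Γ(T, U)) :
    a ∈ (Family.pullback (p ≫ Sigma.ι (fun _ : PartitionOfCorank m δ => SpecZ.{u}) Q)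
      (universalFamily m δ)).sections U ↔ IsConstOn Q.1 a := by
  rw [pullback_universalFamily]
  exact mem_ofOpens_of_le (isDisjointCover_sigmaOpen.preimage _) fun x _ => ⟨p x, rfl⟩

end Territory

theorem mainTheorem10 (m δ : ℕ) :
    (Territory.territoryFunctor.{u} m δ).IsRepresentable ∧
    ∀ (Ter : Territory.LocNoethScheme.{u})
      (h : (Territory.territoryFunctor.{u} m δ).RepresentableBy Ter),
      ∃ e : Ter.obj ≅ ∐ (fun _ : Territory.PartitionOfCorank m δ => Territory.SpecZ.{u}),
        ∀ (Q : Territory.PartitionOfCorank m δ) (S : Territory.LocNoethScheme.{u})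
          (p : S.obj ⟶ Territory.SpecZ.{u}) (U : S.obj.Opens) (a : Fin m → Γ(S.obj, U)),
          a ∈ (Territory.Family.toSubalgebraSheaf (m := m) (δ := δ) (T := S.obj)
                (h.homEquiv (ObjectProperty.homMk
                  (p ≫ Sigma.ι (fun _ : Territory.PartitionOfCorank m δ => Territory.SpecZ.{u}) Q
                    ≫ e.inv)))).sections U ↔
            ∀ P ∈ Q.1.parts, ∀ i ∈ P, ∀ j ∈ P, a i = a j := by
  let h₀ := Territory.territoryRepresentableBy.{u} m δ
  refine ⟨⟨_, ⟨h₀⟩⟩, fun Ter h => ?_⟩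
  let e := h.uniqueUpToIso h₀
  refine ⟨(ObjectProperty.ι _).mapIso e, fun Q S p U a => ?_⟩
  -- By construction `e.inv` is the morphism classifying the universal family, so composing with it
  -- does not change the family attached to `f`.
  have he : ∀ f : S ⟶ Territory.territory m δ, h.homEquiv (f ≫ e.inv) = h₀.homEquiv f := by
    intro f
    rw [h.homEquiv_comp, h₀.homEquiv_eq]
    congr 1
    have hinv : e.inv = h.homEquiv.symm (h₀.homEquiv (𝟙 _)) := rfl
    rw [hinv, Equiv.apply_symm_apply]
  have := he (ObjectProperty.homMk
    (p ≫ Sigma.ι (fun _ : Territory.PartitionOfCorank m δ => Territory.SpecZ.{u}) Q))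
  refine Iff.trans ?_ (Territory.mem_pullback_sigma Q p U a)
  rw [← Category.assoc]
  exact iff_of_eq (congrArg (fun B : Territory.Family m δ S.obj => a ∈ B.sections U) this)
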